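/- Let $d\ge 1$ and $n$ be integers. A $(d-1)$-dimensional complex $X$ on the vertex set $\{1,\dots,n\}$ is identified with its set of $(d-1)$-dimensional faces, and $|X|$ is their number. All cochains are reduced simplicial cochains of the full simplex on $n$ vertices (the empty face is included), and $\delta$ is the coboundary operator. For a $(d-1)$-cochain $\phi$ with coefficients in a field $R$, let the weight $w(\phi)$ be the minimum of $|\mathrm{supp}(\phi')|$ over all $\phi'$ such that $\phi-\phi'$ is a coboundary, and let $b(\phi)$ be the number of $d$-dimensional faces $\sigma$ of the simplex with $(\delta\phi)(\sigma)\neq 0$. Let $b(X)\in\mathbb N\cup\{\infty\}$ be the infimum of $b(\phi)$ over all $R\in\{\mathbb Q\}\cup\{\mathbb Z/q\mathbb Z : q \text{ prime}\}$ and all $(d-1)$-cochains $\phi$ over $R$ with $\mathrm{supp}(\phi)=X$ and $w(\phi)=|X|$. Let $Y_d(n,0)\subseteq Y_d(n,1)\subseteq\cdots\subseteq Y_d(n,\binom{n}{d+1})$ be the stochastic Linial--Meshulam process: $Y_d(n,0)$ is the complete $(d-1)$-dimensional complex on $n$ vertices, and $Y_d(n,i+1)$ arises from $Y_d(n,i)$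 by adding a $d$-dimensional face chosen uniformly at random among those not in $Y_d(n,i)$. For a random complex $Y$ from this process, let $z(X)$ be the event that for $R=\mathbb Q$, or for $R=\mathbb Z/q\mathbb Z$ with some prime $q\le \sqrt{d+1}^{\,|X|}$, there is a $(d-1)$-cocycle $\phi$ of $Y$ over $R$ with $\mathrm{supp}(\phi)=X$ and $w(\phi)=|X|$. **Lemma.** For every $d\ge 1$ and every real $c>d-\tfrac12$ there is $n_0=n_0(d,c)$ such that the following holds for all $n\ge n_0$, all $(d-1)$-dimensional complexes $X$ on $n$ vertices, and all real $\theta$ with $$b(X)=(1-\theta)nk\ \ge\ \frac{nk}{d+1},\qquad k:=|X| .$$ If $Y\sim Y_d\!\left(n,\left\lceil \frac{c\log n}{n}\binom{n}{d+1}\right\rceil\right)$, then $$\Pr\big(z(X)\big)\ \le\ n^{-(1-\theta)(d-1/2)k}.$$ -/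

import Mathlib

open scoped ENNReal

/-- The faces with exactly `k` vertices (that is, of dimension `k - 1`) of the simplex on the
vertex set `Fin n`.  The empty face (`k = 0`) is included, so cochains are reduced cochains. -/
abbrev Face (n k : ℕ) : Type := {s : Finset (Fin n) // s.card = k}

/-- Cochains of the simplex on `n` vertices with coefficients in `R`, on the faces with `k`
vertices.  The value on a face refers to the orientation by the increasing order of its
vertices. -/
abbrev Cochain (n k : ℕ) (R : Type) : Type := Face n k → R

namespace Face

/-- The face of `σ` opposite to its vertex `v`. -/
def opposite {n k : ℕ} (σ : Face n k) (v : {v // v ∈ σ.1}) : Face n (k - 1) :=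
  ⟨σ.1.erase v.1, by rw [Finset.card_erase_of_mem v.2, σ.2]⟩

/-- The position `i` of the vertex `v` in `σ = {v₀ < v₁ < ⋯}`. -/
def position {n k : ℕ} (σ : Face n k) (v : {v // v ∈ σ.1}) : ℕ :=
  (σ.1.filter fun u => u < v.1).card

end Face

namespace Cochain

/-- The simplicial coboundary operator, from faces with `k - 1` vertices to faces with `k`
vertices: `(δψ)({v₀ < ⋯ < v_{k-1}}) = ∑ i, (-1)^i ψ({v₀, …, v̂ᵢ, …, v_{k-1}})`. -/
def coboundary {n : ℕ} {R : Type} [AddCommGroup R] (k : ℕ) (ψ : Cochain n (k - 1) R) :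
    Cochain n k R :=
  fun σ => ∑ v : {v // v ∈ σ.1}, ((-1 : ℤ) ^ σ.position v) • ψ (σ.opposite v)

open Classical in
/-- The support of a cochain, as a set of faces. -/
noncomputable def supp {n k : ℕ} {R : Type} [AddCommGroup R] (φ : Cochain n k R) :
    Finset (Face n k) :=
  Finset.univ.filter fun τ => φ τ ≠ 0

/-- The weight `w(φ)`: the smallest support size of a cochain `φ'` that differs from `φ` by a
coboundary. -/
noncomputable def weight {n k : ℕ} {R : Type} [AddCommGroup R] (φ : Cochain n k R) : ℕ :=
  sInf {w : ℕ | ∃ φ' : Cochain n k R,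
    (∃ ψ : Cochain n (k - 1) R, φ - φ' = coboundary k ψ) ∧ w = (supp φ').card}

/-- `b(φ)`: the number of faces, of dimension one higher and in the full simplex on `n`
vertices, on which the coboundary of `φ` does not vanish. -/
noncomputable def b {n k : ℕ} {R : Type} [AddCommGroup R] (φ : Cochain n k R) : ℕ :=
  (supp (coboundary (k + 1) φ)).card

/-- `φ`, a cochain of dimension `d - 1`, is a cocycle of the complex that has complete
`(d - 1)`-skeleton and whose set of `d`-dimensional faces is `Y`. -/
def IsCocycleOf {n d : ℕ} {R : Type} [AddCommGroup R] (φ : Cochain n d R)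
    (Y : Finset (Face n (d + 1))) : Prop :=
  ∀ σ ∈ Y, coboundary (d + 1) φ σ = 0

end Cochain

/-- `b(X, R)` for a `(d - 1)`-dimensional complex, given by its set `X` of `(d - 1)`-dimensional
faces: the infimum of `b(φ)` over the cochains `φ` supported exactly on `X` and of weight `|X|`.
It is `⊤` if there are none. -/
noncomputable def bOver {n d : ℕ} (X : Finset (Face n d)) (R : Type) [AddCommGroup R] : ℕ∞ :=
  ⨅ φ : {φ : Cochain n d R // φ.supp = X ∧ φ.weight = X.card}, (φ.1.b : ℕ∞)

/-- `b(X)`: the infimum of `b(X, R)` over `R = ℤ/qℤ`, `q` prime, and `R = ℚ`. -/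
noncomputable def bComplex {n d : ℕ} (X : Finset (Face n d)) : ℕ∞ :=
  min (⨅ q : {q : ℕ // q.Prime}, bOver X (ZMod q.1)) (bOver X ℚ)

/-- The event `z(X, R)`, for the complex with complete `(d - 1)`-skeleton and set `Y` of
`d`-dimensional faces. -/
def zOver {n d : ℕ} (X : Finset (Face n d)) (R : Type) [AddCommGroup R]
    (Y : Finset (Face n (d + 1))) : Prop :=
  ∃ φ : Cochain n d R, φ.IsCocycleOf Y ∧ φ.weight = X.card ∧ φ.supp = X

/-- The event `z(X)`: `z(X, R)` holds for `R = ℚ` or for `R = ℤ/qℤ` with some prime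
`q ≤ √(d + 1) ^ |X|`. -/
def zComplex {n d : ℕ} (X : Finset (Face n d)) (Y : Finset (Face n (d + 1))) : Prop :=
  (∃ q : ℕ, q.Prime ∧ (q : ℝ) ≤ √((d : ℝ) + 1) ^ X.card ∧ zOver X (ZMod q) Y) ∨ zOver X ℚ Y

open Classical in
/-- One step of the stochastic Linial–Meshulam process: add a `d`-dimensional face chosen
uniformly among those not in `Y` (and stop if there is none). -/
noncomputable def linialMeshulamStep {n d : ℕ} (Y : Finset (Face n (d + 1))) :
    PMF (Finset (Face n (d + 1))) :=
  if h : (Yᶜ).Nonempty then (PMF.uniformOfFinset Yᶜ h).map fun σ => insert σ Y else PMF.pure Y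

/-- The law of `Y_d(n, m)`, the state after `m` steps of the Linial–Meshulam process that starts
from the complete `(d - 1)`-dimensional complex; a state is given by its set of
`d`-dimensional faces. -/
noncomputable def linialMeshulam (d n : ℕ) : ℕ → PMF (Finset (Face n (d + 1)))
  | 0 => PMF.pure ∅
  | m + 1 => (linialMeshulam d n m).bind linialMeshulamStep

/-! Fix a field `R`, and let `r` be the dimension of the space of cocycles of the current complex
that vanish outside `X`. While `z(X, R)` holds, a witness `φ` exists, and its coboundary is nonzero
on at least `b(X)` faces, none of them added yet. Adding any of these expels `φ` from the space and
lowers `r`; other faces never raise `r`. So the potential `T ^ r`, set to `0` once `z(X, R)` fails,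
shrinks in expectation at each step by a factor at most `exp (-b(X) (1 - T⁻¹) / N)`, with `N` the
number of `d`-faces. The witness may change from step to step, so no count of cochains is needed,
even over `ℚ`.

The potential starts at most `T ^ |X|` and is at least `1` on `z(X, R)`, so Markov's inequality
bounds the probability for each field. A union bound over the primes costs only a factor exponential
in `|X|`. As `c > d - 1/2`, a large constant `T` leaves a spare power of `n` that absorbs all such
factors. -/

namespace Cochain

variable {n d : ℕ} {R : Type}

/-! ### Cocycles supported in `X`. -/

theorem coboundary_add [AddCommGroup R] (k : ℕ) (φ ψ : Cochain n (k - 1) R) :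
    coboundary k (φ + ψ) = coboundary k φ + coboundary k ψ := by
  funext σ
  simp only [coboundary, Pi.add_apply, smul_add, Finset.sum_add_distrib]

theorem coboundary_smul [Field R] (k : ℕ) (a : R) (φ : Cochain n (k - 1) R) :
    coboundary k (a • φ) = a • coboundary k φ := by
  funext σ
  simp only [coboundary, Pi.smul_apply, Finset.smul_sum]
  exact Finset.sum_congr rfl fun v _ => smul_comm _ _ _

theorem mem_supp [AddCommGroup R] {φ : Cochain n d R} {τ : Face n d} :
    τ ∈ supp φ ↔ φ τ ≠ 0 := by
  simp [supp]

/-- The cocycles, of the complex with complete skeleton and set `Y` of top-dimensional faces, that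
vanish outside `X`. -/
def cocyclesOn (R : Type) [Field R] (X : Finset (Face n d)) (Y : Finset (Face n (d + 1))) :
    Submodule R (Cochain n d R) where
  carrier := {φ | (∀ τ, τ ∉ X → φ τ = 0) ∧ φ.IsCocycleOf Y}
  add_mem' := by
    rintro φ ψ ⟨h₁, h₂⟩ ⟨h₃, h₄⟩
    refine ⟨fun τ hτ => by simp [h₁ τ hτ, h₃ τ hτ], fun σ hσ => ?_⟩
    have h := congrFun (coboundary_add (d + 1) φ ψ) σ
    rw [h, Pi.add_apply, h₂ σ hσ, h₄ σ hσ, add_zero]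
  zero_mem' := ⟨fun _ _ => rfl, fun σ _ => by simp [coboundary]⟩
  smul_mem' := by
    rintro a φ ⟨h₁, h₂⟩
    refine ⟨fun τ hτ => by simp [h₁ τ hτ], fun σ hσ => ?_⟩
    have h := congrFun (coboundary_smul (d + 1) a φ) σ
    rw [h, Pi.smul_apply, h₂ σ hσ, smul_zero]

theorem cocyclesOn_anti [Field R] (X : Finset (Face n d)) {Y Y' : Finset (Face n (d + 1))}
    (h : Y ⊆ Y') : cocyclesOn R X Y' ≤ cocyclesOn R X Y :=
  fun _ hφ => ⟨hφ.1, fun σ hσ => hφ.2 σ (h hσ)⟩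

theorem finrank_cocyclesOn_anti [Field R] (X : Finset (Face n d))
    {Y Y' : Finset (Face n (d + 1))} (h : Y ⊆ Y') :
    Module.finrank R (cocyclesOn R X Y') ≤ Module.finrank R (cocyclesOn R X Y) :=
  Submodule.finrank_mono (cocyclesOn_anti X h)

open Classical in
theorem finrank_cocyclesOn_insert_lt [Field R] {X : Finset (Face n d)}
    {Y : Finset (Face n (d + 1))} {φ : Cochain n d R} (hφ : φ ∈ cocyclesOn R X Y)
    {σ : Face n (d + 1)} (hσ : coboundary (d + 1) φ σ ≠ 0) :
    Module.finrank R (cocyclesOn R X (insert σ Y)) < Module.finrank R (cocyclesOn R X Y) := by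
  refine Submodule.finrank_lt_finrank_of_lt
    (lt_of_le_of_ne (cocyclesOn_anti X (Finset.subset_insert σ Y)) fun h => hσ ?_)
  rw [← h] at hφ
  exact hφ.2 σ (Finset.mem_insert_self σ Y)

theorem finrank_cocyclesOn_le [Field R] (X : Finset (Face n d)) (Y : Finset (Face n (d + 1))) :
    Module.finrank R (cocyclesOn R X Y) ≤ X.card := by
  have h := LinearMap.finrank_le_finrank_of_injective
    (f := (LinearMap.funLeft R R (fun τ : X => τ.1)).comp (cocyclesOn R X Y).subtype) (by
      rintro ⟨φ, hφ⟩ ⟨ψ, hψ⟩ h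
      refine Subtype.ext (funext fun τ => ?_)
      by_cases hτ : τ ∈ X
      · exact congrFun h ⟨τ, hτ⟩
      · exact (hφ.1 τ hτ).trans (hψ.1 τ hτ).symm)
  simpa using h

end Cochain

theorem zOver_anti {n d : ℕ} {X : Finset (Face n d)} {R : Type} [AddCommGroup R]
    {Y Y' : Finset (Face n (d + 1))} (h : Y ⊆ Y') (hz : zOver X R Y') : zOver X R Y := by
  obtain ⟨φ, h₁, h₂⟩ := hz
  exact ⟨φ, fun σ hσ => h₁ σ (h hσ), h₂⟩

theorem le_b_of_le_bOver {n d : ℕ} {X : Finset (Face n d)} {R : Type} [AddCommGroup R] {β : ℕ}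
    (hβ : (β : ℕ∞) ≤ bOver X R) {φ : Cochain n d R} (hs : φ.supp = X)
    (hw : φ.weight = X.card) : β ≤ φ.b := by
  unfold bOver at hβ
  exact Nat.cast_le.1 (le_iInf_iff.1 hβ ⟨φ, hs, hw⟩)

/-! ### Expectations under a `PMF`. -/

theorem PMF.tsum_bind_mul {α β : Type*} (p : PMF α) (f : α → PMF β) (F : β → ℝ≥0∞) :
    ∑' b, p.bind f b * F b = ∑' a, p a * ∑' b, f a b * F b := by
  simp only [PMF.bind_apply, ← ENNReal.tsum_mul_right, ← ENNReal.tsum_mul_left]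
  rw [ENNReal.tsum_comm]
  simp only [mul_assoc]

theorem PMF.tsum_pure_mul {α : Type*} (a : α) (F : α → ℝ≥0∞) :
    ∑' b, PMF.pure a b * F b = F a := by
  classical
  rw [tsum_eq_single a fun b hb => by simp [PMF.pure_apply, hb]]
  simp

theorem PMF.tsum_map_mul {α β : Type*} (p : PMF α) (f : α → β) (F : β → ℝ≥0∞) :
    ∑' b, p.map f b * F b = ∑' a, p a * F (f a) := by
  rw [PMF.map, PMF.tsum_bind_mul]
  simp only [Function.comp_apply, PMF.tsum_pure_mul]

/-! ### Decay of the potential along the process. -/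

open Classical in
/-- The potential `T ^ r`, where `r` is the dimension of the space of cocycles supported in `X`,
as long as the event `z(X, R)` holds, and `0` afterwards. -/
noncomputable def cocyclePotential {n d : ℕ} (R : Type) [Field R] (X : Finset (Face n d)) (T : ℝ)
    (Y : Finset (Face n (d + 1))) : ℝ :=
  if zOver X R Y then T ^ Module.finrank R (Cochain.cocyclesOn R X Y) else 0

open Classical in
theorem sum_cocyclePotential_insert_le {n d : ℕ} {R : Type} [Field R] {X : Finset (Face n d)}
    {β : ℕ} (hβ : (β : ℕ∞) ≤ bOver X R) {T : ℝ} (hT : 1 ≤ T) {Y : Finset (Face n (d + 1))}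
    (hz : zOver X R Y) :
    ∑ σ ∈ Yᶜ, cocyclePotential R X T (insert σ Y) ≤
      (((Yᶜ).card : ℝ) - β * (1 - T⁻¹)) * cocyclePotential R X T Y := by
  obtain ⟨φ, hφY, hw, hs⟩ := id hz
  have hT0 : 0 < T := by linarith
  have hTi : T⁻¹ ≤ 1 := inv_le_one_of_one_le₀ hT
  set r := Module.finrank R (Cochain.cocyclesOn R X Y) with hr
  have hmem : φ ∈ Cochain.cocyclesOn R X Y := by
    refine ⟨fun τ hτ => ?_, hφY⟩
    by_contra h
    exact hτ (hs ▸ Cochain.mem_supp.2 h)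
  set B := Cochain.supp (Cochain.coboundary (d + 1) φ) with hB
  have hBY : B ⊆ Yᶜ := by
    intro σ hσ
    rw [Finset.mem_compl]
    exact fun h => Cochain.mem_supp.1 hσ (hφY σ h)
  have hβB : β ≤ B.card := le_b_of_le_bOver hβ hs hw
  have hβB' : (β : ℝ) ≤ B.card := by exact_mod_cast hβB
  have hY : cocyclePotential R X T Y = T ^ r := if_pos hz
  have hpt : ∀ σ, cocyclePotential R X T (insert σ Y) ≤
      T ^ r - if σ ∈ B then (1 - T⁻¹) * T ^ r else 0 := by
    intro σ
    split_ifs with hσ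
    · have hlt := Cochain.finrank_cocyclesOn_insert_lt hmem (Cochain.mem_supp.1 hσ)
      have hle : cocyclePotential R X T (insert σ Y) ≤ T ^ (r - 1) := by
        unfold cocyclePotential
        split_ifs
        · exact pow_le_pow_right₀ hT (by omega)
        · positivity
      -- The strict drop `hlt` forces `r > 0`, so the truncated subtraction is genuine.
      have hpow : T ^ r = T * T ^ (r - 1) := by
        rw [← pow_succ', Nat.sub_add_cancel (by omega)]
      have : T ^ r - (1 - T⁻¹) * T ^ r = T ^ (r - 1) := by
        rw [hpow]; field_simp; ring
      linarith
    · rw [sub_zero]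
      unfold cocyclePotential
      split_ifs
      · exact pow_le_pow_right₀ hT
          (Cochain.finrank_cocyclesOn_anti X (Finset.subset_insert σ Y))
      · positivity
  calc ∑ σ ∈ Yᶜ, cocyclePotential R X T (insert σ Y)
      ≤ ∑ σ ∈ Yᶜ, (T ^ r - if σ ∈ B then (1 - T⁻¹) * T ^ r else 0) :=
        Finset.sum_le_sum fun σ _ => hpt σ
    _ = ((Yᶜ).card : ℝ) * T ^ r - B.card * ((1 - T⁻¹) * T ^ r) := by
        rw [Finset.sum_sub_distrib, Finset.sum_const, nsmul_eq_mul, ← Finset.sum_filter,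
          Finset.filter_mem_eq_inter, Finset.inter_eq_right.2 hBY, Finset.sum_const, nsmul_eq_mul]
    _ ≤ (((Yᶜ).card : ℝ) - β * (1 - T⁻¹)) * T ^ r := by
        have : (β : ℝ) * ((1 - T⁻¹) * T ^ r) ≤ B.card * ((1 - T⁻¹) * T ^ r) :=
          mul_le_mul_of_nonneg_right hβB' (mul_nonneg (by linarith) (by positivity))
        linarith
    _ = _ := by rw [hY]

theorem cocyclePotential_nonneg {n d : ℕ} {R : Type} [Field R] (X : Finset (Face n d)) {T : ℝ}
    (hT : 0 ≤ T) (Y : Finset (Face n (d + 1))) : 0 ≤ cocyclePotential R X T Y := by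
  unfold cocyclePotential
  split_ifs <;> positivity

theorem Face.card_eq_choose (n k : ℕ) : Fintype.card (Face n k) = n.choose k := by
  simp [Face]

theorem tsum_linialMeshulamStep_mul_le {n d : ℕ} {R : Type} [Field R] {X : Finset (Face n d)}
    {β : ℕ} (hβ : (β : ℕ∞) ≤ bOver X R) (hβ0 : 0 < β) {T : ℝ} (hT : 1 ≤ T)
    (Y : Finset (Face n (d + 1))) :
    ∑' Y', linialMeshulamStep Y Y' * ENNReal.ofReal (cocyclePotential R X T Y') ≤
      ENNReal.ofReal (Real.exp (-(β * (1 - T⁻¹) / n.choose (d + 1)))) *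
        ENNReal.ofReal (cocyclePotential R X T Y) := by
  classical
  have hTi : T⁻¹ ≤ 1 := inv_le_one_of_one_le₀ hT
  have hnn := cocyclePotential_nonneg (R := R) X (zero_le_one.trans hT)
  by_cases hz : zOver X R Y
  · have hsum := sum_cocyclePotential_insert_le hβ hT hz
    have hne : (Yᶜ).Nonempty := by
      obtain ⟨φ, hφY, hw, hs⟩ := id hz
      obtain ⟨σ, hσ⟩ := Finset.card_pos.1 (hβ0.trans_le (le_b_of_le_bOver hβ hs hw))
      exact ⟨σ, Finset.mem_compl.2 fun hY => Cochain.mem_supp.1 hσ (hφY σ hY)⟩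
    have hs0 : (0 : ℝ) < (Yᶜ).card := by exact_mod_cast hne.card_pos
    have hsN : ((Yᶜ).card : ℝ) ≤ n.choose (d + 1) := by
      exact_mod_cast (Finset.card_le_univ _).trans_eq (Face.card_eq_choose n (d + 1))
    have hstep : linialMeshulamStep Y =
        (PMF.uniformOfFinset Yᶜ hne).map fun σ => insert σ Y := by
      unfold linialMeshulamStep
      rw [dif_pos hne]
    rw [hstep, PMF.tsum_map_mul, tsum_fintype, ← Finset.sum_subset (Finset.subset_univ Yᶜ)
      (fun σ _ hσ => by rw [PMF.uniformOfFinset_apply_of_notMem _ hσ, zero_mul])]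
    rw [Finset.sum_congr rfl fun σ hσ => by rw [PMF.uniformOfFinset_apply_of_mem hne hσ],
      ← Finset.mul_sum, ← ENNReal.ofReal_sum_of_nonneg fun σ _ => hnn _,
      ← ENNReal.ofReal_natCast, ← ENNReal.ofReal_inv_of_pos hs0,
      ← ENNReal.ofReal_mul (by positivity), ← ENNReal.ofReal_mul (by positivity)]
    refine ENNReal.ofReal_le_ofReal ?_
    rw [inv_mul_le_iff₀ hs0, ← mul_assoc]
    refine hsum.trans (mul_le_mul_of_nonneg_right ?_ (hnn Y))
    have hb : (0 : ℝ) ≤ β * (1 - T⁻¹) := mul_nonneg (by positivity) (by linarith)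
    -- Replacing the number of remaining faces by `N` makes the decay rate independent of `Y`.
    have h₁ : β * (1 - T⁻¹) / n.choose (d + 1) ≤ β * (1 - T⁻¹) / (Yᶜ).card :=
      div_le_div_of_nonneg_left hb hs0 hsN
    have h₂ := Real.add_one_le_exp (-(β * (1 - T⁻¹) / n.choose (d + 1)))
    calc ((Yᶜ).card : ℝ) - β * (1 - T⁻¹)
        = (Yᶜ).card * (1 - β * (1 - T⁻¹) / (Yᶜ).card) := by field_simp
      _ ≤ _ := mul_le_mul_of_nonneg_left (by linarith) hs0.le
  -- Once lost, the event cannot return, so the potential stays `0`.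
  · have h0 : ∀ Y', Y ⊆ Y' → cocyclePotential R X T Y' = 0 := fun Y' h =>
      if_neg fun hz' => hz (zOver_anti h hz')
    unfold linialMeshulamStep
    split_ifs with hne
    · rw [PMF.tsum_map_mul]
      simp [h0 _ (Finset.subset_insert _ Y)]
    · rw [PMF.tsum_pure_mul]
      simp [h0 Y subset_rfl]

theorem tsum_linialMeshulam_mul_le {n d : ℕ} {R : Type} [Field R] {X : Finset (Face n d)}
    {β : ℕ} (hβ : (β : ℕ∞) ≤ bOver X R) (hβ0 : 0 < β) {T : ℝ} (hT : 1 ≤ T) (m : ℕ) :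
    ∑' Y, linialMeshulam d n m Y * ENNReal.ofReal (cocyclePotential R X T Y) ≤
      ENNReal.ofReal (Real.exp (-(β * (1 - T⁻¹) / n.choose (d + 1)))) ^ m *
        ENNReal.ofReal (T ^ X.card) := by
  induction m with
  | zero =>
    rw [linialMeshulam, PMF.tsum_pure_mul, pow_zero, one_mul]
    refine ENNReal.ofReal_le_ofReal ?_
    unfold cocyclePotential
    split_ifs
    · exact pow_le_pow_right₀ hT (Cochain.finrank_cocyclesOn_le X _)
    · positivity
  | succ m ih =>
    rw [linialMeshulam, PMF.tsum_bind_mul]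
    refine (ENNReal.tsum_le_tsum fun Y => mul_le_mul_right
      (tsum_linialMeshulamStep_mul_le hβ hβ0 hT Y) _).trans ?_
    simp only [mul_left_comm _ (ENNReal.ofReal (Real.exp _))]
    rw [ENNReal.tsum_mul_left, pow_succ', mul_assoc]
    gcongr

/-- Markov's inequality: the potential dominates the indicator of the event because `T ≥ 1`. -/
theorem linialMeshulam_zOver_le {n d : ℕ} {R : Type} [Field R] {X : Finset (Face n d)}
    {β : ℕ} (hβ : (β : ℕ∞) ≤ bOver X R) (hβ0 : 0 < β) {T : ℝ} (hT : 1 ≤ T) (m : ℕ) :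
    (linialMeshulam d n m).toOuterMeasure {Y | zOver X R Y} ≤
      ENNReal.ofReal (Real.exp (-(m * (β * (1 - T⁻¹) / n.choose (d + 1)))) * T ^ X.card) := by
  classical
  have hT0 : 0 ≤ T := by linarith
  rw [ENNReal.ofReal_mul (by positivity), ← mul_neg, Real.exp_nat_mul,
    ENNReal.ofReal_pow (by positivity)]
  refine le_trans ?_ (tsum_linialMeshulam_mul_le hβ hβ0 hT m)
  rw [PMF.toOuterMeasure_apply]
  refine ENNReal.tsum_le_tsum fun Y => ?_
  by_cases hz : zOver X R Y
  · rw [Set.indicator_of_mem (show Y ∈ {Y | zOver X R Y} from hz), cocyclePotential, if_pos hz]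
    exact le_mul_of_one_le_right' (by
      rw [ENNReal.one_le_ofReal]
      exact one_le_pow₀ hT)
  · rw [Set.indicator_of_notMem (show Y ∉ {Y | zOver X R Y} from hz)]
    exact zero_le

/-- Union bound over the admissible primes and `ℚ`; the `+ 1` accounts for `ℚ`. -/
theorem linialMeshulam_zComplex_le {n d : ℕ} {X : Finset (Face n d)} {β : ℕ}
    (hβ : bComplex X = (β : ℕ∞)) (hβ0 : 0 < β) {T : ℝ} (hT : 1 ≤ T) (m : ℕ) :
    (linialMeshulam d n m).toOuterMeasure {Y | zComplex X Y} ≤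
      ENNReal.ofReal ((√((d : ℝ) + 1) ^ X.card + 1) *
        (Real.exp (-(m * (β * (1 - T⁻¹) / n.choose (d + 1)))) * T ^ X.card)) := by
  classical
  set Q : ℝ := √((d : ℝ) + 1) ^ X.card with hQ
  have hQ0 : 0 ≤ Q := by positivity
  set P : ℝ := Real.exp (-(m * (β * (1 - T⁻¹) / n.choose (d + 1)))) * T ^ X.card with hP
  set μ := (linialMeshulam d n m).toOuterMeasure
  set S : Finset ℕ := (Finset.Icc 1 ⌊Q⌋₊).filter Nat.Prime with hS
  have hsub : {Y | zComplex X Y} ⊆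
      (⋃ q ∈ S, {Y | zOver X (ZMod q) Y}) ∪ {Y | zOver X ℚ Y} := by
    rintro Y (⟨q, hq, hqQ, hz⟩ | hz)
    · refine Or.inl (Set.mem_biUnion (x := q) ?_ hz)
      rw [Finset.mem_coe, hS, Finset.mem_filter, Finset.mem_Icc]
      exact ⟨⟨hq.one_le, Nat.le_floor hqQ⟩, hq⟩
    · exact Or.inr hz
  have hrat : μ {Y | zOver X ℚ Y} ≤ ENNReal.ofReal P :=
    linialMeshulam_zOver_le (hβ ▸ min_le_right _ _) hβ0 hT m
  have hmod : ∀ q ∈ S, μ {Y | zOver X (ZMod q) Y} ≤ ENNReal.ofReal P := by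
    intro q hq
    have hp : q.Prime := (Finset.mem_filter.1 hq).2
    have : Fact q.Prime := ⟨hp⟩
    refine linialMeshulam_zOver_le (R := ZMod q) ?_ hβ0 hT m
    rw [← hβ]
    exact (min_le_left _ _).trans
      (iInf_le (fun q : {q : ℕ // q.Prime} => bOver X (ZMod q.1)) ⟨q, hp⟩)
  calc μ {Y | zComplex X Y}
      ≤ μ (⋃ q ∈ S, {Y | zOver X (ZMod q) Y}) + μ {Y | zOver X ℚ Y} :=
        (MeasureTheory.measure_mono hsub).trans (MeasureTheory.measure_union_le _ _)
    _ ≤ (∑ _q ∈ S, ENNReal.ofReal P) + ENNReal.ofReal P :=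
        add_le_add ((MeasureTheory.measure_biUnion_finset_le _ _).trans (Finset.sum_le_sum hmod))
          hrat
    _ = ENNReal.ofReal ((S.card + 1) * P) := by
        rw [Finset.sum_const, nsmul_eq_mul, ENNReal.ofReal_mul (p := S.card + 1) (by positivity),
          ENNReal.ofReal_add (by positivity) zero_le_one, ENNReal.ofReal_natCast,
          ENNReal.ofReal_one, add_mul, one_mul]
    _ ≤ ENNReal.ofReal ((Q + 1) * P) := by
        have hT0 : 0 ≤ T := by linarith
        have hcard : (S.card : ℝ) ≤ Q := by
          have h : S.card ≤ ⌊Q⌋₊ := (Finset.card_filter_le _ _).trans (by simp)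
          exact (Nat.cast_le.2 h).trans (Nat.floor_le hQ0)
        gcongr

/-! ### Choice of parameters and asymptotics. -/

theorem mainTheorem5 (d : ℕ) (hd : 1 ≤ d) (c : ℝ) (hc : (d : ℝ) - 1 / 2 < c) :
    ∃ n₀ : ℕ, ∀ n : ℕ, n₀ ≤ n →
      ∀ (X : Finset (Face n d)) (k : ℕ) (θ : ℝ) (β : ℕ),
        X.card = k →
        bComplex X = (β : ℕ∞) →
        (β : ℝ) = (1 - θ) * n * k →
        (1 - θ) * n * k ≥ (n : ℝ) * k / (d + 1) →
        (linialMeshulam d n ⌈c * Real.log n / n * (n.choose (d + 1) : ℝ)⌉₊).toOuterMeasure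
            {Y | zComplex X Y} ≤
          ENNReal.ofReal ((n : ℝ) ^ (-(1 - θ) * ((d : ℝ) - 1 / 2) * k)) := by
  have hd' : (1 : ℝ) ≤ d := by exact_mod_cast hd
  set a : ℝ := (d : ℝ) - 1 / 2 with ha
  have ha0 : 0 < a := by linarith
  have hc0 : 0 < c := ha0.trans hc
  obtain ⟨T, hT1, ε, hε, hcT⟩ : ∃ T : ℝ, 1 ≤ T ∧ ∃ ε : ℝ, 0 < ε ∧ c * (1 - T⁻¹) = a + ε := by
    -- This `T` puts `c * (1 - T⁻¹)` at the midpoint of `a` and `c`.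
    refine ⟨2 * c / (c - a), ?_, (c - a) / 2, by linarith, ?_⟩
    · rw [le_div_iff₀ (by linarith)]; linarith
    · rw [inv_div]; field_simp; ring
  have hT0 : 0 < T := by linarith
  have hlim : Filter.Tendsto (fun n : ℕ => (n : ℝ) ^ (ε / (d + 1))) Filter.atTop Filter.atTop :=
    (tendsto_rpow_atTop (by positivity)).comp tendsto_natCast_atTop_atTop
  -- The exponent `ε / (d + 1)` is available since `1 - θ ≥ 1 / (d + 1)`; thus `n₁` depends on
  -- neither `X` nor `θ`.
  obtain ⟨n₁, hn₁⟩ := Filter.eventually_atTop.1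
    (hlim.eventually_ge_atTop (2 * √((d : ℝ) + 1) * T))
  refine ⟨max n₁ (d + 1), fun n hn X k θ β hX hb hβ hθ => ?_⟩
  have hnd : d + 1 ≤ n := (le_max_right _ _).trans hn
  have hn1 : (1 : ℝ) ≤ n := by exact_mod_cast (by omega : 1 ≤ n)
  have hn0 : (0 : ℝ) < n := by linarith
  -- For `k = 0` the claimed bound is `1`.
  rcases Nat.eq_zero_or_pos k with rfl | hk
  · simp only [Nat.cast_zero, mul_zero, Real.rpow_zero, ENNReal.ofReal_one]
    refine (MeasureTheory.measure_mono (Set.subset_univ _)).trans_eq ?_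
    exact (PMF.toOuterMeasure_apply_eq_one_iff _ _).2 (Set.subset_univ _)
  have hk0 : (0 : ℝ) < k := by exact_mod_cast hk
  have hu : 1 / ((d : ℝ) + 1) ≤ 1 - θ := by
    have h : 1 / ((d : ℝ) + 1) * (n * k) ≤ (1 - θ) * (n * k) := by
      calc _ = (n : ℝ) * k / (d + 1) := by ring
        _ ≤ _ := by linarith
    exact le_of_mul_le_mul_right h (by positivity)
  have hu0 : 0 < 1 - θ := lt_of_lt_of_le (by positivity) hu
  have hβ0 : 0 < β := by
    have : (0 : ℝ) < β := by rw [hβ]; positivity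
    exact_mod_cast this
  refine (linialMeshulam_zComplex_le hb hβ0 hT1 _).trans (ENNReal.ofReal_le_ofReal ?_)
  set N : ℝ := (n.choose (d + 1) : ℝ) with hN
  have hN0 : 0 < N := Nat.cast_pos.2 (Nat.choose_pos hnd)
  set m := ⌈c * Real.log n / n * N⌉₊
  have hm : c * Real.log n / n * N ≤ m := Nat.le_ceil _
  have hTi : 0 ≤ 1 - T⁻¹ := sub_nonneg.2 (inv_le_one_of_one_le₀ hT1)
  have hexp : Real.exp (-(m * (β * (1 - T⁻¹) / N))) ≤ (n : ℝ) ^ (-((a + ε) * ((1 - θ) * k))) := by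
    rw [Real.rpow_def_of_pos hn0]
    refine Real.exp_le_exp.2 ?_
    rw [mul_neg, neg_le_neg_iff]
    calc Real.log n * ((a + ε) * ((1 - θ) * k))
        = c * Real.log n / n * N * (β * (1 - T⁻¹) / N) := by
          rw [← hcT, hβ]; field_simp
      _ ≤ m * (β * (1 - T⁻¹) / N) := mul_le_mul_of_nonneg_right hm (by positivity)
  have hsq : (1 : ℝ) ≤ √((d : ℝ) + 1) := Real.one_le_sqrt.2 (by linarith)
  have hcount : √((d : ℝ) + 1) ^ k + 1 ≤ (2 * √((d : ℝ) + 1)) ^ k := by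
    have h₁ : (1 : ℝ) ≤ √((d : ℝ) + 1) ^ k := one_le_pow₀ hsq
    have h₂ : (2 : ℝ) ≤ 2 ^ k := le_self_pow₀ (by norm_num) hk.ne'
    rw [mul_pow]
    nlinarith
  have hconst : (2 * √((d : ℝ) + 1) * T) ^ k ≤ (n : ℝ) ^ (ε * ((1 - θ) * k)) := by
    calc (2 * √((d : ℝ) + 1) * T) ^ k ≤ ((n : ℝ) ^ (ε * (1 - θ))) ^ k := by
          refine pow_le_pow_left₀ (by positivity)
            ((hn₁ n ((le_max_left _ _).trans hn)).trans ?_) k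
          refine Real.rpow_le_rpow_of_exponent_le hn1 ?_
          rw [div_eq_mul_one_div]
          exact mul_le_mul_of_nonneg_left hu hε.le
      _ = _ := by rw [← Real.rpow_natCast, ← Real.rpow_mul hn0.le, mul_assoc]
  rw [hX]
  calc (√((d : ℝ) + 1) ^ k + 1) * (Real.exp (-(m * (β * (1 - T⁻¹) / N))) * T ^ k)
      ≤ (2 * √((d : ℝ) + 1)) ^ k * ((n : ℝ) ^ (-((a + ε) * ((1 - θ) * k))) * T ^ k) := by
        gcongr
    _ = (2 * √((d : ℝ) + 1) * T) ^ k * (n : ℝ) ^ (-((a + ε) * ((1 - θ) * k))) := by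
        rw [mul_pow _ T]; ring
    _ ≤ (n : ℝ) ^ (ε * ((1 - θ) * k)) * (n : ℝ) ^ (-((a + ε) * ((1 - θ) * k))) := by
        gcongr
    _ = (n : ℝ) ^ (-(1 - θ) * a * k) := by
        rw [← Real.rpow_add hn0]
        congr 1
        ring
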